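/- Let $A,B_1,B_2\in\mathbb{R}$ satisfy $A\ge 0$, $A+B_1\ge 0$, $A+B_1+B_2\ge 0$, $B_1\ne 0$ and $B_2\ne 0$, let $\theta$ be the Heaviside step function ($\theta(x)=1$ for $x>0$ and $\theta(x)=0$ otherwise), and for $x,t_1,t_2\in\mathbb{R}$ put $$w(x,t_1,t_2)=e^{-x^2}\bigl(A+B_1\theta(x-t_1)+B_2\theta(x-t_2)\bigr).$$ For an integer $n\ge 0$ let $$D_n(t_1,t_2)=\frac1{n!}\int_{\mathbb{R}^n}\prod_{1\le j<k\le n}(x_k-x_j)^2\prod_{j=1}^n w(x_j,t_1,t_2)\,dx_1\cdots dx_n ,$$ and $\sigma_n(t_1,t_2)=\partial_{t_1}\ln D_n(t_1,t_2)+\partial_{t_2}\ln D_n(t_1,t_2)$. On the region $t_1<t_2$ the function $D_n$ is positive, the functions $\ln D_n$ and $\sigma=\sigma_n$ are infinitely differentiable, and $\sigma$ satisfies the second-order partial differential equation $$\bigl[(2t_1\partial_{t_1}\sigma+2t_2\partial_{t_2}\sigma-2\sigma)^2-\Delta_1-\Delta_2\bigr]^2=4\Delta_1\Delta_2 ,$$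 where $$\Delta_1=(\partial_{t_1}^2\sigma+\partial_{t_1}\partial_{t_2}\sigma)^2+4(\partial_{t_1}\sigma)^2(2n+\partial_{t_1}\sigma+\partial_{t_2}\sigma),$$ $$\Delta_2=(\partial_{t_2}^2\sigma+\partial_{t_2}\partial_{t_1}\sigma)^2+4(\partial_{t_2}\sigma)^2(2n+\partial_{t_1}\sigma+\partial_{t_2}\sigma).$$ -/

import Mathlib

open scoped ContDiff

noncomputable section

namespace GaussJumps

/-- The Heaviside step function: `1` for `x > 0` and `0` otherwise. -/
def heaviside (x : ℝ) : ℝ := if 0 < x then 1 else 0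

/-- The Gaussian weight with two jumps,
`w(x, t₁, t₂) = exp(-x²) (A + B₁ θ(x - t₁) + B₂ θ(x - t₂))`. -/
def weight (A B₁ B₂ t₁ t₂ x : ℝ) : ℝ :=
  Real.exp (-x ^ 2) * (A + B₁ * heaviside (x - t₁) + B₂ * heaviside (x - t₂))

/-- `D_n(t₁, t₂) = (1 / n!) ∫_{ℝⁿ} ∏_{j < k} (x_k - x_j)² ∏_j w(x_j, t₁, t₂) dx`. -/
def D (A B₁ B₂ : ℝ) (n : ℕ) (t₁ t₂ : ℝ) : ℝ :=
  1 / (n.factorial : ℝ) *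
    ∫ x : Fin n → ℝ, (∏ j : Fin n, ∏ k ∈ Finset.Ioi j, (x k - x j) ^ 2) *
      ∏ j : Fin n, weight A B₁ B₂ t₁ t₂ (x j)

/-- Partial derivative with respect to the first variable. -/
def pd₁ (f : ℝ → ℝ → ℝ) (t₁ t₂ : ℝ) : ℝ := deriv (fun s => f s t₂) t₁

/-- Partial derivative with respect to the second variable. -/
def pd₂ (f : ℝ → ℝ → ℝ) (t₁ t₂ : ℝ) : ℝ := deriv (fun s => f t₁ s) t₂

/-- `ln D_n(t₁, t₂)`. -/
def logD (A B₁ B₂ : ℝ) (n : ℕ) (t₁ t₂ : ℝ) : ℝ := Real.log (D A B₁ B₂ n t₁ t₂)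

/-- `σ_n = ∂_{t₁} ln D_n + ∂_{t₂} ln D_n`. -/
def sigma (A B₁ B₂ : ℝ) (n : ℕ) (t₁ t₂ : ℝ) : ℝ :=
  pd₁ (logD A B₁ B₂ n) t₁ t₂ + pd₂ (logD A B₁ B₂ n) t₁ t₂

/-- `Δ₁ = (∂₁² σ + ∂₁ ∂₂ σ)² + 4 (∂₁ σ)² (2 n + ∂₁ σ + ∂₂ σ)`. -/
def Delta₁ (n : ℕ) (σ : ℝ → ℝ → ℝ) (t₁ t₂ : ℝ) : ℝ :=
  (pd₁ (pd₁ σ) t₁ t₂ + pd₁ (pd₂ σ) t₁ t₂) ^ 2 +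
    4 * (pd₁ σ t₁ t₂) ^ 2 * (2 * (n : ℝ) + pd₁ σ t₁ t₂ + pd₂ σ t₁ t₂)

/-- `Δ₂ = (∂₂² σ + ∂₂ ∂₁ σ)² + 4 (∂₂ σ)² (2 n + ∂₁ σ + ∂₂ σ)`. -/
def Delta₂ (n : ℕ) (σ : ℝ → ℝ → ℝ) (t₁ t₂ : ℝ) : ℝ :=
  (pd₂ (pd₂ σ) t₁ t₂ + pd₂ (pd₁ σ) t₁ t₂) ^ 2 +
    4 * (pd₂ σ t₁ t₂) ^ 2 * (2 * (n : ℝ) + pd₁ σ t₁ t₂ + pd₂ σ t₁ t₂)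

end GaussJumps

end

/-! Let L be integration against the weight, P_j its monic orthogonal polynomials, h_j = L(P_j²),
p_j the coefficient of x^(j-1) in P_j, and E_i = B_i exp(-t_i²). For t₁ < t₂ the functional L is
positive, and Heine's formula gives D_n = h_0 ⋯ h_{n-1} (`D_eq_prod_sqNorm`). Two facts about the
jumps drive everything: ∂_{t_i} L(f) = -E_i f(t_i), and integration by parts, E₁ f(t₁) + E₂ f(t₂) =
2 L(xf) - L(f').

The first gives ∂_{t_i} ln h_j = -E_i P_j(t_i)²/h_j and ∂_{t_i} p_n = E_i P_n(t_i)
P_{n-1}(t_i)/h_{n-1}. The second, with f = P_j², makes the sum defining σ telescope to 2 p_n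
(`sigma_eq`). With f = P_n P_{n-1} it gives 2n + ∂₁σ + ∂₂σ = 4β, where β = h_n/h_{n-1}. Hence ∂_i∂₁σ
+ ∂_i∂₂σ = 4 ∂_iβ, and (a - b)² + 4ab = (a + b)² turns Δ_i into S_i², where S_i = 4E_i (h_n
P_{n-1}(t_i)² + h_{n-1} P_n(t_i)²)/h_{n-1}² (`jump_discriminant`). Finally f = x P_n P_{n-1} gives
2t₁∂₁σ + 2t₂∂₂σ - 2σ = S₁ + S₂, so the equation is ((S₁ + S₂)² - S₁² - S₂²)² = 4 S₁² S₂². -/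

namespace GaussJumps

/-! ### Orthogonal polynomials of a positive functional -/

section OrthogonalPolynomials

open Polynomial

/-- The monic orthogonal polynomials of a linear functional, by Gram–Schmidt. -/
noncomputable def op (L : ℝ[X] →ₗ[ℝ] ℝ) : ℕ → ℝ[X]
  | n => X ^ n - ∑ j : Fin n, C (L (X ^ n * op L j) / L (op L j * op L j)) * op L j

/-- A functional is positive if it is positive on nonzero squares. -/
def PosFunctional (L : ℝ[X] →ₗ[ℝ] ℝ) : Prop := ∀ f : ℝ[X], f ≠ 0 → 0 < L (f * f)

/-- The squared norms of the monic orthogonal polynomials. -/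
noncomputable def sqNorm (L : ℝ[X] →ₗ[ℝ] ℝ) (n : ℕ) : ℝ := L (op L n * op L n)

/-- The coefficient of degree `n - 1` of the `n`-th monic orthogonal polynomial (`0` for `n = 0`). -/
noncomputable def subCoeff (L : ℝ[X] →ₗ[ℝ] ℝ) (n : ℕ) : ℝ := (X * op L n).coeff n

variable {L : ℝ[X] →ₗ[ℝ] ℝ}

lemma subCoeff_zero : subCoeff L 0 = 0 := by simp [subCoeff]

lemma subCoeff_succ (n : ℕ) : subCoeff L (n + 1) = (op L (n + 1)).coeff n := by
  simp [subCoeff, coeff_X_mul]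

lemma op_monic_natDegree (L : ℝ[X] →ₗ[ℝ] ℝ) (n : ℕ) : (op L n).Monic ∧ (op L n).natDegree = n := by
  induction n using Nat.strong_induction_on with
  | _ n ih =>
    have hdeg : (-∑ j : Fin n, C (L (X ^ n * op L j) / L (op L j * op L j)) * op L j).degree
        < (n : WithBot ℕ) := by
      rw [degree_neg, degree_lt_iff_coeff_zero]
      intro m hm
      rw [finsetSum_coeff]
      refine Finset.sum_eq_zero fun j _ => ?_
      rw [coeff_C_mul, coeff_eq_zero_of_natDegree_lt, mul_zero]
      rw [(ih j j.2).2]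
      exact lt_of_lt_of_le j.2 hm
    have hmon := monic_X_pow_add hdeg
    rw [op, sub_eq_add_neg]
    refine ⟨hmon, ?_⟩
    apply natDegree_eq_of_degree_eq_some
    rw [degree_add_eq_left_of_degree_lt, degree_X_pow]
    rwa [degree_X_pow]

lemma op_monic (n : ℕ) : (op L n).Monic := (op_monic_natDegree L n).1

lemma natDegree_op (n : ℕ) : (op L n).natDegree = n := (op_monic_natDegree L n).2

lemma coeff_op_self (n : ℕ) : (op L n).coeff n = 1 := by
  have := (op_monic (L := L) n).coeff_natDegree
  rwa [natDegree_op] at this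

lemma sqNorm_pos (hL : PosFunctional L) (n : ℕ) : 0 < sqNorm L n := hL _ (op_monic n).ne_zero

lemma map_C_mul_functional (a : ℝ) (f : ℝ[X]) : L (C a * f) = a * L f := by
  rw [← smul_eq_C_mul, map_smul, smul_eq_mul]

lemma map_op_mul_op (hL : PosFunctional L) (n : ℕ) : ∀ m < n, L (op L n * op L m) = 0 := by
  induction n using Nat.strong_induction_on with
  | _ n ih =>
    intro m hm
    rw [op, sub_mul, map_sub, Finset.sum_mul, map_sum, sub_eq_zero,
      Finset.sum_eq_single (⟨m, hm⟩ : Fin n)]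
    · rw [mul_assoc, map_C_mul_functional, div_mul_cancel₀]
      exact (sqNorm_pos hL m).ne'
    · intro j _ hj
      rw [mul_assoc, map_C_mul_functional]
      have hne : (j : ℕ) ≠ m := fun h => hj (Fin.ext h)
      rcases lt_or_gt_of_ne hne with h | h
      · rw [mul_comm (op L j) (op L m), ih m hm j h, mul_zero]
      · rw [ih j j.2 m h, mul_zero]
    · simp

lemma map_op_mul_op_of_ne (hL : PosFunctional L) {n m : ℕ} (h : n ≠ m) :
    L (op L n * op L m) = 0 := by
  rcases lt_or_gt_of_ne h with h | h
  · rw [mul_comm]; exact map_op_mul_op hL _ _ h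
  · exact map_op_mul_op hL _ _ h

/-- The descent step for expanding a polynomial in the monic orthogonal basis: the top terms cancel.
-/
lemma natDegree_sub_C_mul_op_le {q : ℝ[X]} {k : ℕ} (hq : q.natDegree ≤ k + 1) :
    (q - C (q.coeff (k + 1)) * op L (k + 1)).natDegree ≤ k := by
  rw [natDegree_le_iff_coeff_eq_zero]
  intro m hm
  rw [coeff_sub, coeff_C_mul]
  rcases eq_or_lt_of_le (Nat.succ_le_of_lt hm) with h | h
  · rw [← h, Nat.succ_eq_add_one, coeff_op_self]; ring
  · rw [coeff_eq_zero_of_natDegree_lt (lt_of_le_of_lt hq h),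
      coeff_eq_zero_of_natDegree_lt (p := op L (k + 1)) (by rw [natDegree_op]; exact h)]
    ring

lemma map_op_mul_of_natDegree_lt (hL : PosFunctional L) {n : ℕ} :
    ∀ (k : ℕ) (q : ℝ[X]), k < n → q.natDegree ≤ k → L (op L n * q) = 0 := by
  intro k
  induction k with
  | zero =>
    intro q hn hq
    have h0 : op L 0 = 1 := by
      have := natDegree_op (L := L) 0
      exact (op_monic 0).natDegree_eq_zero.mp this
    have := map_op_mul_op hL n 0 hn
    rw [h0, mul_one] at this
    rw [eq_C_of_natDegree_le_zero hq, mul_comm, map_C_mul_functional, this, mul_zero]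
  | succ k ih =>
    intro q hn hq
    have h := ih _ (by omega) (natDegree_sub_C_mul_op_le (L := L) hq)
    rw [mul_sub, map_sub, mul_left_comm, map_C_mul_functional, map_op_mul_op hL n _ hn] at h
    linarith

/-- Modulo lower degree, q is a multiple of `op L n`, and lower degrees are orthogonal to it. All
pairings below are read off from a single coefficient in this way. -/
lemma map_op_mul (hL : PosFunctional L) {n : ℕ} {q : ℝ[X]} (hq : q.natDegree ≤ n) :
    L (op L n * q) = q.coeff n * sqNorm L n := by
  rcases n with _ | n
  · have h0 : op L 0 = 1 := (op_monic 0).natDegree_eq_zero.mp (natDegree_op (L := L) 0)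
    rw [sqNorm, h0, one_mul, one_mul, ← map_C_mul_functional, mul_one,
      ← eq_C_of_natDegree_le_zero hq]
  · have h := map_op_mul_of_natDegree_lt hL n _ (Nat.lt_succ_self n)
      (natDegree_sub_C_mul_op_le (L := L) hq)
    rw [mul_sub, map_sub, mul_left_comm, map_C_mul_functional] at h
    rw [sqNorm]
    linarith

lemma natDegree_X_mul_op_le (n : ℕ) : (X * op L n).natDegree ≤ n + 1 := by
  refine natDegree_mul_le.trans ?_
  rw [natDegree_op, natDegree_X, add_comm]

lemma natDegree_X_mul_op_sub_le (n : ℕ) : (X * op L n - op L (n + 1)).natDegree ≤ n := by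
  have h := natDegree_sub_C_mul_op_le (L := L) (natDegree_X_mul_op_le (L := L) n)
  rwa [coeff_X_mul, coeff_op_self, C_1, one_mul] at h

lemma coeff_X_mul_op_sub (n : ℕ) :
    (X * op L n - op L (n + 1)).coeff n = subCoeff L n - subCoeff L (n + 1) := by
  rw [coeff_sub, subCoeff, subCoeff_succ]

/-- The factor `subCoeff L n - subCoeff L (n + 1)` is the diagonal coefficient of the three-term
recurrence. -/
lemma map_X_mul_op_sq (hL : PosFunctional L) (n : ℕ) :
    L (X * (op L n * op L n)) = (subCoeff L n - subCoeff L (n + 1)) * sqNorm L n := by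
  have h := map_op_mul hL (natDegree_X_mul_op_sub_le (L := L) n)
  rw [coeff_X_mul_op_sub, mul_sub, map_sub, map_op_mul_op_of_ne hL (by omega), sub_zero] at h
  rw [← h]; congr 1; ring

lemma map_op_mul_derivative (hL : PosFunctional L) (n : ℕ) :
    L (op L n * derivative (op L n)) = 0 := by
  rw [map_op_mul hL ((natDegree_derivative_le _).trans (by rw [natDegree_op]; omega)),
    coeff_derivative, coeff_eq_zero_of_natDegree_lt (by rw [natDegree_op]; omega)]
  ring

/-! ### Boundary identities from integration by parts -/

section IntegrationByParts

variable {E₁ E₂ t₁ t₂ : ℝ}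

lemma boundary_op_sq (hL : PosFunctional L)
    (ibp : ∀ f : ℝ[X], E₁ * f.eval t₁ + E₂ * f.eval t₂ = 2 * L (X * f) - L (derivative f)) (n : ℕ) :
    E₁ * (op L n).eval t₁ ^ 2 + E₂ * (op L n).eval t₂ ^ 2 =
      2 * (subCoeff L n - subCoeff L (n + 1)) * sqNorm L n := by
  have h := ibp (op L n * op L n)
  rw [map_X_mul_op_sq hL, derivative_mul, mul_comm (derivative _), map_add,
    map_op_mul_derivative hL, eval_mul, eval_mul] at h
  linear_combination h

lemma boundary_op_mul_op (hL : PosFunctional L)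
    (ibp : ∀ f : ℝ[X], E₁ * f.eval t₁ + E₂ * f.eval t₂ = 2 * L (X * f) - L (derivative f)) (m : ℕ) :
    E₁ * ((op L (m + 1)).eval t₁ * (op L m).eval t₁) +
      E₂ * ((op L (m + 1)).eval t₂ * (op L m).eval t₂) =
      2 * sqNorm L (m + 1) - (m + 1) * sqNorm L m := by
  have h := ibp (op L (m + 1) * op L m)
  have h1 : L (X * (op L (m + 1) * op L m)) = sqNorm L (m + 1) := by
    rw [mul_left_comm, map_op_mul hL (natDegree_X_mul_op_le m), coeff_X_mul, coeff_op_self, one_mul]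
  have h2 : L (op L m * derivative (op L (m + 1))) = (m + 1) * sqNorm L m := by
    rw [map_op_mul hL ((natDegree_derivative_le _).trans (by rw [natDegree_op]; omega)),
      coeff_derivative, coeff_op_self, one_mul]
  have h3 : L (op L (m + 1) * derivative (op L m)) = 0 :=
    map_op_mul_of_natDegree_lt hL m _ (by omega)
      ((natDegree_derivative_le _).trans (by rw [natDegree_op]; omega))
  rw [h1, derivative_mul, mul_comm (derivative _), map_add, h2, h3, eval_mul, eval_mul] at h
  linear_combination h

/-- The extra factor X in the test polynomial produces the explicit t₁, t₂ of the differential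
equation. -/
lemma boundary_X_mul_op_mul_op (hL : PosFunctional L)
    (ibp : ∀ f : ℝ[X], E₁ * f.eval t₁ + E₂ * f.eval t₂ = 2 * L (X * f) - L (derivative f)) (m : ℕ) :
    E₁ * (t₁ * ((op L (m + 1)).eval t₁ * (op L m).eval t₁)) +
      E₂ * (t₂ * ((op L (m + 1)).eval t₂ * (op L m).eval t₂)) =
      2 * ((subCoeff L m - subCoeff L (m + 1)) * sqNorm L (m + 1) +
        (subCoeff L (m + 1) - subCoeff L (m + 2)) * sqNorm L (m + 1)) +
      subCoeff L (m + 1) * sqNorm L m := by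
  have h := ibp (X * (op L (m + 1) * op L m))
  have h1 : L (X * (X * (op L (m + 1) * op L m))) =
      (subCoeff L m - subCoeff L (m + 1)) * sqNorm L (m + 1) +
        (subCoeff L (m + 1) - subCoeff L (m + 2)) * sqNorm L (m + 1) := by
    -- Split x²P_{m+1}P_m as P_{m+1}·x(xP_m - P_{m+1}) + xP_{m+1}²; subtracting P_{m+1} lowers the
    -- degree enough for `map_op_mul`.
    have hd : (X * (X * op L m - op L (m + 1))).natDegree ≤ m + 1 := by
      refine natDegree_mul_le.trans ?_
      have := natDegree_X_mul_op_sub_le (L := L) m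
      rw [natDegree_X]; omega
    have := map_op_mul hL hd
    rw [coeff_X_mul, coeff_X_mul_op_sub] at this
    rw [← map_X_mul_op_sq hL, ← this, ← map_add]
    congr 1; ring
  have h2 : L (op L m * (X * derivative (op L (m + 1)))) = -subCoeff L (m + 1) * sqNorm L m := by
    have hd : (X * derivative (op L (m + 1))).natDegree ≤ m + 1 := by
      refine natDegree_mul_le.trans ?_
      have := natDegree_derivative_le (op L (m + 1))
      rw [natDegree_op] at this
      rw [natDegree_X]; omega
    -- Removing (m+1)P_{m+1} from xP'_{m+1} leaves degree at most m, with coefficient m·p - (m+1)·p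
    -- = -p there.
    have h' := map_op_mul hL (natDegree_sub_C_mul_op_le (L := L) hd)
    have hc : (X * derivative (op L (m + 1))).coeff m = m * (op L (m + 1)).coeff m := by
      rcases m with _ | m
      · simp
      · rw [coeff_X_mul, coeff_derivative]; push_cast; ring
    rw [mul_sub, map_sub, mul_left_comm, mul_left_comm (op L m), map_C_mul_functional,
      map_op_mul_op_of_ne hL (by omega), coeff_sub, coeff_C_mul, hc, coeff_X_mul, coeff_derivative,
      coeff_op_self, ← subCoeff_succ] at h'
    rw [mul_left_comm]
    linear_combination h'
  have h3 : L (op L (m + 1) * (X * derivative (op L m))) = 0 := by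
    refine map_op_mul_of_natDegree_lt hL m _ (by omega) ?_
    -- Truncated subtraction in the degree of a derivative spoils the bound at m = 0, where the
    -- derivative of P_0 = 1 vanishes anyway.
    rcases m with _ | m
    · rw [(op_monic 0).natDegree_eq_zero.mp (natDegree_op (L := L) 0)]; simp
    · refine natDegree_mul_le.trans ?_
      have := natDegree_derivative_le (op L (m + 1))
      rw [natDegree_op] at this
      rw [natDegree_X]; omega
  have h4 : derivative (X * (op L (m + 1) * op L m)) =
      op L (m + 1) * op L m + op L m * (X * derivative (op L (m + 1))) +
        op L (m + 1) * (X * derivative (op L m)) := by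
    rw [derivative_mul, derivative_mul, derivative_X]; ring
  rw [h1, h4, map_add, map_add, h2, h3, map_op_mul_op_of_ne hL (by omega)] at h
  simp only [eval_mul, eval_X] at h
  linear_combination h

end IntegrationByParts

end OrthogonalPolynomials

/-! ### The Gaussian moment functional with two jumps -/

section MomentFunctional

open Polynomial MeasureTheory Set Filter Topology

lemma integrable_eval_mul_exp (f : ℝ[X]) :
    Integrable fun x : ℝ => f.eval x * Real.exp (-x ^ 2) := by
  have h : ∀ k : ℕ, Integrable fun x : ℝ => x ^ k * Real.exp (-x ^ 2) := fun k => by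
    have := integrable_rpow_mul_exp_neg_mul_sq (b := 1) one_pos (s := k)
      (by have : (0 : ℝ) ≤ k := k.cast_nonneg
          linarith)
    simpa using this
  simp_rw [eval_eq_sum_range, Finset.sum_mul, mul_assoc]
  exact integrable_finsetSum _ fun k _ => (h k).const_mul _

/-- Integration against the Gaussian over a set. -/
noncomputable def gaussOn (s : Set ℝ) : ℝ[X] →ₗ[ℝ] ℝ where
  toFun f := ∫ x in s, f.eval x * Real.exp (-x ^ 2)
  map_add' f g := by
    simp_rw [eval_add, add_mul]
    exact integral_add (integrable_eval_mul_exp f).integrableOn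
      (integrable_eval_mul_exp g).integrableOn
  map_smul' a f := by
    simp_rw [eval_smul, smul_eq_mul, mul_assoc]
    exact integral_const_mul _ _

lemma gaussOn_apply (s : Set ℝ) (f : ℝ[X]) :
    gaussOn s f = ∫ x in s, f.eval x * Real.exp (-x ^ 2) := rfl

/-- Integration against the weight with two jumps. -/
noncomputable def momentFunctional (A B₁ B₂ t₁ t₂ : ℝ) : ℝ[X] →ₗ[ℝ] ℝ :=
  A • gaussOn univ + B₁ • gaussOn (Ioi t₁) + B₂ • gaussOn (Ioi t₂)

lemma momentFunctional_apply (A B₁ B₂ t₁ t₂ : ℝ) (f : ℝ[X]) :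
    momentFunctional A B₁ B₂ t₁ t₂ f =
      A * gaussOn univ f + B₁ * gaussOn (Ioi t₁) f + B₂ * gaussOn (Ioi t₂) f := rfl

lemma eval_mul_weight (A B₁ B₂ t₁ t₂ : ℝ) (f : ℝ[X]) :
    (fun x => f.eval x * weight A B₁ B₂ t₁ t₂ x) = fun x =>
      (A * (f.eval x * Real.exp (-x ^ 2)) +
        B₁ * (Ioi t₁).indicator (fun x => f.eval x * Real.exp (-x ^ 2)) x) +
        B₂ * (Ioi t₂).indicator (fun x => f.eval x * Real.exp (-x ^ 2)) x := by
  ext x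
  simp only [weight, heaviside, indicator, mem_Ioi, sub_pos]
  split_ifs <;> ring

lemma integrable_eval_mul_weight (A B₁ B₂ t₁ t₂ : ℝ) (f : ℝ[X]) :
    Integrable fun x => f.eval x * weight A B₁ B₂ t₁ t₂ x := by
  rw [eval_mul_weight]
  have h := integrable_eval_mul_exp f
  exact ((h.const_mul _).add ((h.indicator measurableSet_Ioi).const_mul _)).add
    ((h.indicator measurableSet_Ioi).const_mul _)

lemma momentFunctional_eq_integral (A B₁ B₂ t₁ t₂ : ℝ) (f : ℝ[X]) :
    momentFunctional A B₁ B₂ t₁ t₂ f = ∫ x, f.eval x * weight A B₁ B₂ t₁ t₂ x := by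
  have h := integrable_eval_mul_exp f
  have h0 := h.const_mul A
  have h1 := (h.indicator (measurableSet_Ioi (a := t₁))).const_mul B₁
  have h2 := (h.indicator (measurableSet_Ioi (a := t₂))).const_mul B₂
  have h01 : Integrable fun x => A * (f.eval x * Real.exp (-x ^ 2)) +
      B₁ * (Ioi t₁).indicator (fun x => f.eval x * Real.exp (-x ^ 2)) x := h0.add h1
  rw [eval_mul_weight, integral_add h01 h2, integral_add h0 h1,
    integral_const_mul, integral_const_mul, integral_const_mul,
    integral_indicator measurableSet_Ioi, integral_indicator measurableSet_Ioi,
    momentFunctional_apply, gaussOn_apply, gaussOn_apply, gaussOn_apply, Measure.restrict_univ]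

lemma hasDerivAt_eval_mul_exp (f : ℝ[X]) (x : ℝ) :
    HasDerivAt (fun x => f.eval x * Real.exp (-x ^ 2))
      ((derivative f - C 2 * (X * f)).eval x * Real.exp (-x ^ 2)) x := by
  have h1 : HasDerivAt (fun x : ℝ => Real.exp (-x ^ 2)) (Real.exp (-x ^ 2) * (-(2 * x))) x := by
    have := ((hasDerivAt_pow 2 x).neg).exp
    simpa using this
  refine ((f.hasDerivAt x).mul h1).congr_deriv ?_
  simp only [eval_sub, eval_mul, eval_C, eval_X]
  ring

lemma gaussOn_univ_derivative (f : ℝ[X]) :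
    gaussOn univ (derivative f - C 2 * (X * f)) = 0 := by
  rw [gaussOn_apply, Measure.restrict_univ]
  exact integral_eq_zero_of_hasDerivAt_of_integrable (hasDerivAt_eval_mul_exp f)
    (integrable_eval_mul_exp _) (integrable_eval_mul_exp _)

lemma gaussOn_Ioi_derivative (f : ℝ[X]) (t : ℝ) :
    gaussOn (Ioi t) (derivative f - C 2 * (X * f)) = -(f.eval t * Real.exp (-t ^ 2)) := by
  have hd := hasDerivAt_eval_mul_exp f
  rw [gaussOn_apply, integral_Ioi_of_hasDerivAt_of_tendsto' (fun x _ => hd x)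
    (integrable_eval_mul_exp _).integrableOn
    (tendsto_zero_of_hasDerivAt_of_integrableOn_Ioi (a := t) (fun x _ => hd x)
      (integrable_eval_mul_exp _).integrableOn (integrable_eval_mul_exp _).integrableOn), zero_sub]

/-- Integration by parts for the weight with two jumps. -/
lemma momentFunctional_ibp (A B₁ B₂ t₁ t₂ : ℝ) (f : ℝ[X]) :
    B₁ * Real.exp (-t₁ ^ 2) * f.eval t₁ + B₂ * Real.exp (-t₂ ^ 2) * f.eval t₂ =
      2 * momentFunctional A B₁ B₂ t₁ t₂ (X * f) -
        momentFunctional A B₁ B₂ t₁ t₂ (derivative f) := by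
  have h := momentFunctional_apply A B₁ B₂ t₁ t₂ (derivative f - C 2 * (X * f))
  rw [gaussOn_univ_derivative, gaussOn_Ioi_derivative, gaussOn_Ioi_derivative, map_sub,
    map_C_mul_functional] at h
  linear_combination h

lemma hasDerivAt_gaussOn_Ioi (f : ℝ[X]) (t : ℝ) :
    HasDerivAt (fun s => gaussOn (Ioi s) f) (-(f.eval t * Real.exp (-t ^ 2))) t := by
  have hi := integrable_eval_mul_exp f
  have hc : Continuous fun x : ℝ => f.eval x * Real.exp (-x ^ 2) := by
    have := f.continuous
    fun_prop
  have h : (fun s => gaussOn (Ioi s) f) = fun s =>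
      gaussOn (Ioi 0) f - ∫ x in (0 : ℝ)..s, f.eval x * Real.exp (-x ^ 2) := by
    ext s
    rw [gaussOn_apply, gaussOn_apply,
      ← intervalIntegral.integral_Ioi_sub_Ioi' hi.integrableOn hi.integrableOn]
    ring
  rw [h]
  exact (hc.integral_hasStrictDerivAt 0 t).hasDerivAt.const_sub _

lemma contDiff_gaussOn_Ioi (f : ℝ[X]) : ContDiff ℝ ∞ fun s => gaussOn (Ioi s) f := by
  rw [contDiff_infty_iff_deriv]
  refine ⟨fun t => (hasDerivAt_gaussOn_Ioi f t).differentiableAt, ?_⟩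
  rw [show deriv (fun s => gaussOn (Ioi s) f) = fun t => -(f.eval t * Real.exp (-t ^ 2)) from
    funext fun t => (hasDerivAt_gaussOn_Ioi f t).deriv]
  have : ContDiff ℝ ∞ fun t => f.eval t := by
    simp_rw [eval_eq_sum_range]
    fun_prop
  fun_prop

lemma contDiff_momentFunctional (A B₁ B₂ : ℝ) (f : ℝ[X]) :
    ContDiff ℝ ∞ fun p : ℝ × ℝ => momentFunctional A B₁ B₂ p.1 p.2 f := by
  simp_rw [momentFunctional_apply]
  have h := contDiff_gaussOn_Ioi f
  have h1 : ContDiff ℝ ∞ fun p : ℝ × ℝ => gaussOn (Ioi p.1) f := h.comp contDiff_fst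
  have h2 : ContDiff ℝ ∞ fun p : ℝ × ℝ => gaussOn (Ioi p.2) f := h.comp contDiff_snd
  fun_prop

lemma hasDerivAt_momentFunctional_left (A B₁ B₂ t₁ t₂ : ℝ) (f : ℝ[X]) :
    HasDerivAt (fun s => momentFunctional A B₁ B₂ s t₂ f)
      (-(B₁ * Real.exp (-t₁ ^ 2)) * f.eval t₁) t₁ := by
  simp_rw [momentFunctional_apply]
  refine ((((hasDerivAt_gaussOn_Ioi f t₁).const_mul B₁).const_add _).add_const _).congr_deriv ?_
  ring

lemma hasDerivAt_momentFunctional_right (A B₁ B₂ t₁ t₂ : ℝ) (f : ℝ[X]) :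
    HasDerivAt (fun s => momentFunctional A B₁ B₂ t₁ s f)
      (-(B₂ * Real.exp (-t₂ ^ 2)) * f.eval t₂) t₂ := by
  simp_rw [momentFunctional_apply]
  refine (((hasDerivAt_gaussOn_Ioi f t₂).const_mul B₂).const_add _).congr_deriv ?_
  ring

lemma weight_nonneg {A B₁ B₂ t₁ t₂ : ℝ} (hA : 0 ≤ A) (hAB₁ : 0 ≤ A + B₁)
    (hAB₁B₂ : 0 ≤ A + B₁ + B₂) (ht : t₁ < t₂) (x : ℝ) : 0 ≤ weight A B₁ B₂ t₁ t₂ x := by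
  refine mul_nonneg (Real.exp_pos _).le ?_
  simp only [heaviside, sub_pos]
  split_ifs <;> linarith

/-- If A > 0, the weight is positive to the left of both jumps. If A = 0, then B₁ > 0 and it is
positive between them. -/
lemma exists_weight_pos {A B₁ B₂ t₁ t₂ : ℝ} (hA : 0 ≤ A) (hAB₁ : 0 ≤ A + B₁)
    (hB₁ : B₁ ≠ 0) (ht : t₁ < t₂) :
    ∃ a b : ℝ, a < b ∧ ∀ x ∈ Ioo a b, 0 < weight A B₁ B₂ t₁ t₂ x := by
  rcases hA.eq_or_lt with rfl | hA
  · refine ⟨t₁, t₂, ht, fun x hx => mul_pos (Real.exp_pos _) ?_⟩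
    have : 0 < B₁ := lt_of_le_of_ne (by linarith) hB₁.symm
    simpa [heaviside, hx.1, hx.2.le.not_gt] using this
  · refine ⟨t₁ - 1, t₁, by linarith, fun x hx => mul_pos (Real.exp_pos _) ?_⟩
    simpa [heaviside, hx.2.le.not_gt, (hx.2.trans ht).le.not_gt] using hA

/-- A nonzero polynomial has finitely many roots, so the integrand is positive almost everywhere on
an interval. -/
lemma posFunctional_momentFunctional {A B₁ B₂ t₁ t₂ : ℝ} (hA : 0 ≤ A) (hAB₁ : 0 ≤ A + B₁)
    (hAB₁B₂ : 0 ≤ A + B₁ + B₂) (hB₁ : B₁ ≠ 0) (ht : t₁ < t₂) :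
    PosFunctional (momentFunctional A B₁ B₂ t₁ t₂) := by
  intro f hf
  rw [momentFunctional_eq_integral, integral_pos_iff_support_of_nonneg _
    (integrable_eval_mul_weight A B₁ B₂ t₁ t₂ _)]
  · obtain ⟨a, b, hab, hpos⟩ := exists_weight_pos (B₂ := B₂) hA hAB₁ hB₁ ht
    have hroots : {x : ℝ | f.eval x = 0}.Finite := by
      refine (f.roots.toFinset.finite_toSet).subset fun x hx => ?_
      simpa [hf] using hx
    have hsub : Ioo a b \ {x : ℝ | f.eval x = 0} ⊆
        Function.support fun x => (f * f).eval x * weight A B₁ B₂ t₁ t₂ x := by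
      intro x hx
      rw [Function.mem_support, eval_mul]
      exact mul_ne_zero (mul_ne_zero hx.2 hx.2) (hpos x hx.1).ne'
    refine lt_of_lt_of_le ?_ (measure_mono hsub)
    rw [measure_sdiff_null (hroots.measure_zero volume), Real.volume_Ioo]
    simpa using hab
  · intro x
    simp only [eval_mul, Pi.zero_apply]
    exact mul_nonneg (mul_self_nonneg _) (weight_nonneg hA hAB₁ hAB₁B₂ ht x)

end MomentFunctional

/-! ### Heine's formula -/

section HeineFormula

open Polynomial MeasureTheory

/-- The Vandermonde determinant is unchanged when the monomials are replaced by monic polynomials of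
the same degrees; both copies are expanded over permutations. -/
lemma prod_sub_sq_eq_sum (L : ℝ[X] →ₗ[ℝ] ℝ) (n : ℕ) (x : Fin n → ℝ) :
    (∏ j : Fin n, ∏ k ∈ Finset.Ioi j, (x k - x j) ^ 2) =
      ∑ σ : Equiv.Perm (Fin n), ∑ τ : Equiv.Perm (Fin n),
        ((Equiv.Perm.sign σ : ℤ) : ℝ) * ((Equiv.Perm.sign τ : ℤ) : ℝ) *
          ∏ j : Fin n, (op L (σ j) * op L (τ j)).eval (x j) := by
  have hdet : (∏ j : Fin n, ∏ k ∈ Finset.Ioi j, (x k - x j)) =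
      ∑ σ : Equiv.Perm (Fin n), ((Equiv.Perm.sign σ : ℤ) : ℝ) *
        ∏ j : Fin n, (op L (σ j)).eval (x j) := by
    rw [← Matrix.det_vandermonde, Matrix.det_eval_matrixOfPolynomials_eq_det_vandermonde x
      (fun i => op L i) (fun i => natDegree_op _) (fun i => op_monic _), ← Matrix.det_transpose,
      Matrix.det_apply']
    rfl
  simp_rw [Finset.prod_pow]
  rw [hdet, sq, Finset.sum_mul_sum]
  refine Finset.sum_congr rfl fun σ _ => Finset.sum_congr rfl fun τ _ => ?_
  simp_rw [eval_mul, Finset.prod_mul_distrib]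
  ring

/-- The multiple integral is the product of the squared norms of the orthogonal polynomials. -/
lemma D_eq_prod_sqNorm {A B₁ B₂ t₁ t₂ : ℝ}
    (hL : PosFunctional (momentFunctional A B₁ B₂ t₁ t₂)) (n : ℕ) :
    D A B₁ B₂ n t₁ t₂ = ∏ j ∈ Finset.range n, sqNorm (momentFunctional A B₁ B₂ t₁ t₂) j := by
  set L := momentFunctional A B₁ B₂ t₁ t₂ with hLdef
  set w := weight A B₁ B₂ t₁ t₂
  have hint : ∀ σ τ : Equiv.Perm (Fin n), Integrable fun x : Fin n → ℝ =>
      ((Equiv.Perm.sign σ : ℤ) : ℝ) * ((Equiv.Perm.sign τ : ℤ) : ℝ) *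
        ∏ j : Fin n, ((op L (σ j) * op L (τ j)).eval (x j) * w (x j)) := fun σ τ =>
    (Integrable.fintype_prod (f := fun j (y : ℝ) => (op L (σ j) * op L (τ j)).eval y * w y)
      fun j => integrable_eval_mul_weight A B₁ B₂ t₁ t₂ _).const_mul _
  have hprod : ∀ σ τ : Equiv.Perm (Fin n), (∫ x : Fin n → ℝ,
      ∏ j : Fin n, ((op L (σ j) * op L (τ j)).eval (x j) * w (x j))) =
        ∏ j : Fin n, L (op L (σ j) * op L (τ j)) := fun σ τ => by
    rw [integral_fintype_prod_volume_eq_prod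
      (f := fun j (y : ℝ) => (op L (σ j) * op L (τ j)).eval y * w y)]
    exact Finset.prod_congr rfl fun j _ => (momentFunctional_eq_integral A B₁ B₂ t₁ t₂ _).symm
  -- Orthogonality kills every τ ≠ σ; the n! surviving diagonal terms are equal and cancel the
  -- prefactor 1/n!.
  have hterm : ∀ σ : Equiv.Perm (Fin n), ∑ τ : Equiv.Perm (Fin n),
      ((Equiv.Perm.sign σ : ℤ) : ℝ) * ((Equiv.Perm.sign τ : ℤ) : ℝ) *
        ∏ j : Fin n, L (op L (σ j) * op L (τ j)) = ∏ j : Fin n, sqNorm L j := fun σ => by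
    rw [Finset.sum_eq_single σ]
    · have hs : ((Equiv.Perm.sign σ : ℤ) : ℝ) * ((Equiv.Perm.sign σ : ℤ) : ℝ) = 1 := by
        rcases Int.units_eq_one_or (Equiv.Perm.sign σ) with h | h <;> simp [h]
      rw [hs, one_mul]
      exact Equiv.prod_comp σ fun j => sqNorm L j
    · intro τ _ hτ
      obtain ⟨j, hj⟩ : ∃ j, σ j ≠ τ j := by
        by_contra! h
        exact hτ (Equiv.ext fun j => (h j).symm)
      rw [Finset.prod_eq_zero (Finset.mem_univ j), mul_zero]
      exact map_op_mul_op_of_ne hL fun h => hj (Fin.ext h)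
    · simp
  have hexp : ∀ x : Fin n → ℝ, (∏ j : Fin n, ∏ k ∈ Finset.Ioi j, (x k - x j) ^ 2) *
      ∏ j : Fin n, w (x j) = ∑ σ : Equiv.Perm (Fin n), ∑ τ : Equiv.Perm (Fin n),
        ((Equiv.Perm.sign σ : ℤ) : ℝ) * ((Equiv.Perm.sign τ : ℤ) : ℝ) *
          ∏ j : Fin n, ((op L (σ j) * op L (τ j)).eval (x j) * w (x j)) := fun x => by
    rw [prod_sub_sq_eq_sum L, Finset.sum_mul]
    refine Finset.sum_congr rfl fun σ _ => ?_
    rw [Finset.sum_mul]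
    refine Finset.sum_congr rfl fun τ _ => ?_
    rw [Finset.prod_mul_distrib]
    ring
  rw [D, integral_congr_ae (ae_of_all _ hexp), integral_finsetSum _ fun σ _ => integrable_finsetSum _ fun τ _ => hint σ τ]
  rw [Finset.sum_congr rfl fun σ _ => integral_finsetSum _ fun τ _ => hint σ τ]
  simp_rw [integral_const_mul, hprod, hterm]
  rw [Finset.sum_const, Finset.card_univ, Fintype.card_perm, Fintype.card_fin, nsmul_eq_mul,
    Finset.prod_range, ← mul_assoc, one_div, inv_mul_cancel₀ (by positivity), one_mul]

end HeineFormula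

/-! ### Smooth dependence on parameters -/

section ParameterDependence

open Polynomial Filter Topology

/-- Reduces a moving functional applied to a moving polynomial to finitely many values on fixed test
polynomials. -/
lemma map_mul_eq_sum (L : ℝ[X] →ₗ[ℝ] ℝ) {F : ℝ[X]} {N : ℕ} (hF : F.natDegree ≤ N) (q : ℝ[X]) :
    L (F * q) = ∑ k ∈ Finset.range (N + 1), F.coeff k * L (X ^ k * q) := by
  conv_lhs => rw [F.as_sum_range_C_mul_X_pow' (Nat.lt_succ_of_le hF)]
  rw [Finset.sum_mul, map_sum]
  exact Finset.sum_congr rfl fun k _ => by rw [mul_assoc, map_C_mul_functional]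

variable {E : Type*} [NormedAddCommGroup E] [NormedSpace ℝ E] {S : Set E}

lemma contDiffOn_coeff_mul {F G : E → ℝ[X]}
    (hF : ∀ k, ContDiffOn ℝ ∞ (fun p => (F p).coeff k) S)
    (hG : ∀ k, ContDiffOn ℝ ∞ (fun p => (G p).coeff k) S) (k : ℕ) :
    ContDiffOn ℝ ∞ (fun p => (F p * G p).coeff k) S := by
  simp_rw [coeff_mul]
  exact ContDiffOn.sum fun ij _ => (hF ij.1).mul (hG ij.2)

lemma contDiffOn_eval {F : E → ℝ[X]} {N : ℕ} (hN : ∀ p, (F p).natDegree ≤ N)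
    (hF : ∀ k, ContDiffOn ℝ ∞ (fun p => (F p).coeff k) S) {τ : E → ℝ} (hτ : ContDiffOn ℝ ∞ τ S) :
    ContDiffOn ℝ ∞ (fun p => (F p).eval (τ p)) S := by
  simp_rw [fun p => eval_eq_sum_range' (Nat.lt_succ_of_le (hN p)) (τ p)]
  exact ContDiffOn.sum fun k _ => (hF k).mul (hτ.pow k)

variable {L : E → ℝ[X] →ₗ[ℝ] ℝ}

lemma contDiffOn_map (hL : ∀ f, ContDiffOn ℝ ∞ (fun p => L p f) S) {F : E → ℝ[X]} {N : ℕ}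
    (hN : ∀ p, (F p).natDegree ≤ N) (hF : ∀ k, ContDiffOn ℝ ∞ (fun p => (F p).coeff k) S) :
    ContDiffOn ℝ ∞ (fun p => L p (F p)) S := by
  have h : ∀ p, L p (F p) = ∑ k ∈ Finset.range (N + 1), (F p).coeff k * L p (X ^ k * 1) :=
    fun p => by rw [← map_mul_eq_sum (L p) (hN p), mul_one]
  simp_rw [h]
  exact ContDiffOn.sum fun k _ => (hF k).mul (hL _)

lemma natDegree_op_mul_op_le (L : ℝ[X] →ₗ[ℝ] ℝ) (n m : ℕ) :
    (op L n * op L m).natDegree ≤ n + m := by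
  refine natDegree_mul_le.trans ?_
  rw [natDegree_op, natDegree_op]

/-- Gram–Schmidt is rational in the moments, and positivity keeps its denominators nonzero. -/
lemma contDiffOn_coeff_op (hL : ∀ f, ContDiffOn ℝ ∞ (fun p => L p f) S)
    (hpos : ∀ p ∈ S, PosFunctional (L p)) (n : ℕ) :
    ∀ k, ContDiffOn ℝ ∞ (fun p => (op (L p) n).coeff k) S := by
  induction n using Nat.strong_induction_on with
  | _ n ih =>
    intro k
    have h : ∀ p, (op (L p) n).coeff k = (X ^ n : ℝ[X]).coeff k - ∑ j : Fin n,
        L p (X ^ n * op (L p) j) / sqNorm (L p) j * (op (L p) j).coeff k := fun p => by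
      rw [op, coeff_sub, finsetSum_coeff]
      simp_rw [coeff_C_mul, sqNorm]
    simp_rw [h]
    refine contDiffOn_const.sub (ContDiffOn.sum fun j _ => ?_)
    refine (ContDiffOn.div ?_ ?_ fun p hp => (sqNorm_pos (hpos p hp) j).ne').mul (ih j j.2 k)
    · refine contDiffOn_map hL (N := n + j) (fun p => ?_)
        (contDiffOn_coeff_mul (fun _ => contDiffOn_const) (ih j j.2))
      refine natDegree_mul_le.trans ?_
      rw [natDegree_op, natDegree_X_pow]
    · exact contDiffOn_map hL (fun p => natDegree_op_mul_op_le (L p) j j)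
        (contDiffOn_coeff_mul (ih j j.2) (ih j j.2))

lemma contDiffOn_sqNorm (hL : ∀ f, ContDiffOn ℝ ∞ (fun p => L p f) S)
    (hpos : ∀ p ∈ S, PosFunctional (L p)) (n : ℕ) :
    ContDiffOn ℝ ∞ (fun p => sqNorm (L p) n) S :=
  contDiffOn_map hL (fun p => natDegree_op_mul_op_le (L p) n n)
    (contDiffOn_coeff_mul (contDiffOn_coeff_op hL hpos n) (contDiffOn_coeff_op hL hpos n))

lemma contDiffOn_subCoeff (hL : ∀ f, ContDiffOn ℝ ∞ (fun p => L p f) S)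
    (hpos : ∀ p ∈ S, PosFunctional (L p)) (n : ℕ) :
    ContDiffOn ℝ ∞ (fun p => subCoeff (L p) n) S :=
  contDiffOn_coeff_mul (F := fun _ => X) (fun _ => contDiffOn_const)
    (contDiffOn_coeff_op hL hpos n) n

end ParameterDependence

/-! ### Derivatives of norms and subleading coefficients -/

section ParameterDerivative

open Polynomial Filter Topology

variable {L : ℝ → ℝ[X] →ₗ[ℝ] ℝ} {c τ s₀ : ℝ}

lemma hasDerivAt_map_mul (hL : ∀ f, HasDerivAt (fun s => L s f) (c * f.eval τ) s₀)
    {F : ℝ → ℝ[X]} {N : ℕ} (hN : ∀ s, (F s).natDegree ≤ N) {F' : ℕ → ℝ}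
    (hF : ∀ k, HasDerivAt (fun s => (F s).coeff k) (F' k) s₀) (q : ℝ[X]) :
    HasDerivAt (fun s => L s (F s * q))
      (L s₀ ((∑ k ∈ Finset.range (N + 1), C (F' k) * X ^ k) * q) + c * ((F s₀).eval τ * q.eval τ))
      s₀ := by
  simp_rw [fun s => map_mul_eq_sum (L s) (hN s) q]
  refine (HasDerivAt.fun_sum fun k _ => (hF k).mul (hL (X ^ k * q))).congr_deriv ?_
  rw [Finset.sum_add_distrib]
  congr 1
  · rw [Finset.sum_mul, map_sum]
    exact Finset.sum_congr rfl fun k _ => by rw [mul_assoc, map_C_mul_functional]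
  · rw [eval_eq_sum_range' (Nat.lt_succ_of_le (hN s₀)) τ, Finset.sum_mul, Finset.mul_sum]
    refine Finset.sum_congr rfl fun k _ => ?_
    rw [eval_mul, eval_pow, eval_X]
    ring

/-- Product rule: G is the parameter derivative of the orthogonal polynomial, and the second term is
the variation of the functional. -/
lemma exists_hasDerivAt_map_op_mul (hL : ∀ f, HasDerivAt (fun s => L s f) (c * f.eval τ) s₀)
    (hd : ∀ n k, DifferentiableAt ℝ (fun s => (op (L s) n).coeff k) s₀) (n : ℕ) :
    ∃ G : ℝ[X], (∀ k, G.coeff k = deriv (fun s => (op (L s) n).coeff k) s₀) ∧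
      ∀ q, HasDerivAt (fun s => L s (op (L s) n * q))
        (L s₀ (G * q) + c * ((op (L s₀) n).eval τ * q.eval τ)) s₀ := by
  refine ⟨∑ k ∈ Finset.range (n + 1),
    C (deriv (fun s => (op (L s) n).coeff k) s₀) * X ^ k, fun k => ?_, fun q =>
    hasDerivAt_map_mul hL (fun s => (natDegree_op (L := L s) n).le)
      (fun k => (hd n k).hasDerivAt) q⟩
  rw [finsetSum_coeff]
  simp_rw [coeff_C_mul, coeff_X_pow, mul_ite, mul_one, mul_zero]
  rw [Finset.sum_ite_eq]
  split_ifs with h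
  · rfl
  · have h0 : (fun s => (op (L s) n).coeff k) = fun _ => 0 := funext fun s =>
      coeff_eq_zero_of_natDegree_lt (by rw [natDegree_op]; simpa using h)
    rw [h0, deriv_const]

lemma coeff_eq_zero_of_eq_deriv_coeff_op {n : ℕ} {G : ℝ[X]}
    (hG : ∀ k, G.coeff k = deriv (fun s => (op (L s) n).coeff k) s₀) {k : ℕ} (hk : n ≤ k) :
    G.coeff k = 0 := by
  rw [hG]
  rcases hk.eq_or_lt with rfl | h
  · simp_rw [coeff_op_self, deriv_const]
  · have h0 : (fun s => (op (L s) n).coeff k) = fun _ => 0 := funext fun s =>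
      coeff_eq_zero_of_natDegree_lt (by rwa [natDegree_op])
    rw [h0, deriv_const]

lemma hasDerivAt_sqNorm (hL : ∀ f, HasDerivAt (fun s => L s f) (c * f.eval τ) s₀)
    (hd : ∀ n k, DifferentiableAt ℝ (fun s => (op (L s) n).coeff k) s₀)
    (hpos : ∀ᶠ s in 𝓝 s₀, PosFunctional (L s)) (n : ℕ) :
    HasDerivAt (fun s => sqNorm (L s) n) (c * (op (L s₀) n).eval τ ^ 2) s₀ := by
  obtain ⟨G, hG, hderiv⟩ := exists_hasDerivAt_map_op_mul hL hd n
  have hGd : G.natDegree ≤ n := natDegree_le_iff_coeff_eq_zero.2 fun k hk =>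
    coeff_eq_zero_of_eq_deriv_coeff_op hG hk.le
  -- The second factor is frozen at s₀: being monic of degree n, it still pairs with `op (L s) n` to
  -- give `sqNorm (L s) n`. The derivative of the first factor has degree below n and drops out.
  have h := hderiv (op (L s₀) n)
  rw [mul_comm G, map_op_mul hpos.self_of_nhds hGd,
    coeff_eq_zero_of_eq_deriv_coeff_op hG le_rfl] at h
  refine (h.congr_of_eventuallyEq ?_).congr_deriv (by ring)
  filter_upwards [hpos] with s hs
  rw [map_op_mul hs (natDegree_op (L := L s₀) n).le, coeff_op_self, one_mul]

/-- Differentiate the orthogonality of P_{m+1}(s) to the frozen P_m(s₀): pairing the derivative of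
P_{m+1}, of degree at most m, with P_m extracts its coefficient of degree m. -/
lemma hasDerivAt_subCoeff (hL : ∀ f, HasDerivAt (fun s => L s f) (c * f.eval τ) s₀)
    (hd : ∀ n k, DifferentiableAt ℝ (fun s => (op (L s) n).coeff k) s₀)
    (hpos : ∀ᶠ s in 𝓝 s₀, PosFunctional (L s)) (m : ℕ) :
    HasDerivAt (fun s => subCoeff (L s) (m + 1))
      (-c * ((op (L s₀) (m + 1)).eval τ * (op (L s₀) m).eval τ) / sqNorm (L s₀) m) s₀ := by
  obtain ⟨G, hG, hderiv⟩ := exists_hasDerivAt_map_op_mul hL hd (m + 1)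
  have hGd : G.natDegree ≤ m := natDegree_le_iff_coeff_eq_zero.2 fun k hk =>
    coeff_eq_zero_of_eq_deriv_coeff_op hG hk
  have h := hderiv (op (L s₀) m)
  have h0 : (fun s => L s (op (L s) (m + 1) * op (L s₀) m)) =ᶠ[𝓝 s₀] fun _ => 0 := by
    filter_upwards [hpos] with s hs
    exact map_op_mul_of_natDegree_lt hs m _ (Nat.lt_succ_self m) (natDegree_op _).le
  have h1 := h.unique ((hasDerivAt_const s₀ (0 : ℝ)).congr_of_eventuallyEq h0)
  rw [mul_comm G, map_op_mul hpos.self_of_nhds hGd, hG] at h1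
  simp_rw [subCoeff_succ]
  refine (hd (m + 1) m).hasDerivAt.congr_deriv ?_
  rw [eq_div_iff (sqNorm_pos hpos.self_of_nhds m).ne']
  linear_combination h1

end ParameterDerivative

/-! ### Partial derivatives on the open region t₁ < t₂ -/

section PartialDerivatives

open Filter Topology

lemma eventually_lt_left {t₁ t₂ : ℝ} (ht : t₁ < t₂) : ∀ᶠ s in 𝓝 t₁, s < t₂ :=
  eventually_lt_nhds ht

lemma eventually_lt_right {t₁ t₂ : ℝ} (ht : t₁ < t₂) : ∀ᶠ s in 𝓝 t₂, t₁ < s :=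
  eventually_gt_nhds ht

lemma pd₁_congr {f g : ℝ → ℝ → ℝ} (h : ∀ t₁ t₂, t₁ < t₂ → f t₁ t₂ = g t₁ t₂) {t₁ t₂ : ℝ}
    (ht : t₁ < t₂) : pd₁ f t₁ t₂ = pd₁ g t₁ t₂ :=
  EventuallyEq.deriv_eq ((eventually_lt_left ht).mono fun s hs => h s t₂ hs)

lemma pd₂_congr {f g : ℝ → ℝ → ℝ} (h : ∀ t₁ t₂, t₁ < t₂ → f t₁ t₂ = g t₁ t₂) {t₁ t₂ : ℝ}
    (ht : t₁ < t₂) : pd₂ f t₁ t₂ = pd₂ g t₁ t₂ :=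
  EventuallyEq.deriv_eq ((eventually_lt_right ht).mono fun s hs => h t₁ s hs)

lemma isOpen_region : IsOpen {p : ℝ × ℝ | p.1 < p.2} := isOpen_lt continuous_fst continuous_snd

lemma differentiableAt_left {f : ℝ × ℝ → ℝ} (hf : ContDiffOn ℝ ∞ f {p : ℝ × ℝ | p.1 < p.2})
    {t₁ t₂ : ℝ} (ht : t₁ < t₂) : DifferentiableAt ℝ (fun s => f (s, t₂)) t₁ := by
  have h : DifferentiableAt ℝ f (t₁, t₂) :=
    (hf.contDiffAt (isOpen_region.mem_nhds ht)).differentiableAt (by simp)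
  exact h.comp (f := fun s => (s, t₂)) t₁ (by fun_prop)

lemma differentiableAt_right {f : ℝ × ℝ → ℝ} (hf : ContDiffOn ℝ ∞ f {p : ℝ × ℝ | p.1 < p.2})
    {t₁ t₂ : ℝ} (ht : t₁ < t₂) : DifferentiableAt ℝ (fun s => f (t₁, s)) t₂ := by
  have h : DifferentiableAt ℝ f (t₁, t₂) :=
    (hf.contDiffAt (isOpen_region.mem_nhds ht)).differentiableAt (by simp)
  exact h.comp (f := fun s => (t₁, s)) t₂ (by fun_prop)

end PartialDerivatives

/-! ### The function σ and its differential equation -/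

section Assembly

open Polynomial Filter Topology

variable {A B₁ B₂ : ℝ}

lemma contDiffOn_momentFunctional (A B₁ B₂ : ℝ) (f : ℝ[X]) :
    ContDiffOn ℝ ∞ (fun p : ℝ × ℝ => momentFunctional A B₁ B₂ p.1 p.2 f)
      {p : ℝ × ℝ | p.1 < p.2} :=
  (contDiff_momentFunctional A B₁ B₂ f).contDiffOn

lemma hasDerivAt_sqNorm_left
    (hpos : ∀ t₁ t₂ : ℝ, t₁ < t₂ → PosFunctional (momentFunctional A B₁ B₂ t₁ t₂))
    {t₁ t₂ : ℝ} (ht : t₁ < t₂) (n : ℕ) :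
    HasDerivAt (fun s => sqNorm (momentFunctional A B₁ B₂ s t₂) n)
      (-(B₁ * Real.exp (-t₁ ^ 2)) * (op (momentFunctional A B₁ B₂ t₁ t₂) n).eval t₁ ^ 2) t₁ :=
  hasDerivAt_sqNorm (hasDerivAt_momentFunctional_left A B₁ B₂ t₁ t₂)
    (fun n k => differentiableAt_left (contDiffOn_coeff_op (contDiffOn_momentFunctional A B₁ B₂)
      (fun p hp => hpos p.1 p.2 hp) n k) ht)
    ((eventually_lt_left ht).mono fun s hs => hpos s t₂ hs) n

lemma hasDerivAt_sqNorm_right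
    (hpos : ∀ t₁ t₂ : ℝ, t₁ < t₂ → PosFunctional (momentFunctional A B₁ B₂ t₁ t₂))
    {t₁ t₂ : ℝ} (ht : t₁ < t₂) (n : ℕ) :
    HasDerivAt (fun s => sqNorm (momentFunctional A B₁ B₂ t₁ s) n)
      (-(B₂ * Real.exp (-t₂ ^ 2)) * (op (momentFunctional A B₁ B₂ t₁ t₂) n).eval t₂ ^ 2) t₂ :=
  hasDerivAt_sqNorm (hasDerivAt_momentFunctional_right A B₁ B₂ t₁ t₂)
    (fun n k => differentiableAt_right (contDiffOn_coeff_op (contDiffOn_momentFunctional A B₁ B₂)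
      (fun p hp => hpos p.1 p.2 hp) n k) ht)
    ((eventually_lt_right ht).mono fun s hs => hpos t₁ s hs) n

lemma logD_eq_sum
    (hpos : ∀ t₁ t₂ : ℝ, t₁ < t₂ → PosFunctional (momentFunctional A B₁ B₂ t₁ t₂))
    (n : ℕ) (t₁ t₂ : ℝ) (ht : t₁ < t₂) :
    logD A B₁ B₂ n t₁ t₂ =
      ∑ j ∈ Finset.range n, Real.log (sqNorm (momentFunctional A B₁ B₂ t₁ t₂) j) := by
  rw [logD, D_eq_prod_sqNorm (hpos t₁ t₂ ht),
    Real.log_prod fun j _ => (sqNorm_pos (hpos t₁ t₂ ht) j).ne']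

/-- The two logarithmic derivatives of each norm add up, by `boundary_op_sq`, to a difference of
consecutive subleading coefficients, and the sum telescopes. -/
lemma sigma_eq
    (hpos : ∀ t₁ t₂ : ℝ, t₁ < t₂ → PosFunctional (momentFunctional A B₁ B₂ t₁ t₂))
    (n : ℕ) (t₁ t₂ : ℝ) (ht : t₁ < t₂) :
    sigma A B₁ B₂ n t₁ t₂ = 2 * subCoeff (momentFunctional A B₁ B₂ t₁ t₂) n := by
  have hL := hpos t₁ t₂ ht
  have h₁ := (HasDerivAt.fun_sum (u := Finset.range n) fun j _ =>
    (hasDerivAt_sqNorm_left hpos ht j).log (sqNorm_pos hL j).ne').deriv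
  have h₂ := (HasDerivAt.fun_sum (u := Finset.range n) fun j _ =>
    (hasDerivAt_sqNorm_right hpos ht j).log (sqNorm_pos hL j).ne').deriv
  rw [sigma, pd₁_congr (logD_eq_sum hpos n) ht, pd₂_congr (logD_eq_sum hpos n) ht, pd₁, pd₂, h₁, h₂,
    ← Finset.sum_add_distrib]
  have hj : ∀ j, -(B₁ * Real.exp (-t₁ ^ 2)) *
      (op (momentFunctional A B₁ B₂ t₁ t₂) j).eval t₁ ^ 2 /
        sqNorm (momentFunctional A B₁ B₂ t₁ t₂) j +
      -(B₂ * Real.exp (-t₂ ^ 2)) * (op (momentFunctional A B₁ B₂ t₁ t₂) j).eval t₂ ^ 2 /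
        sqNorm (momentFunctional A B₁ B₂ t₁ t₂) j =
      2 * subCoeff (momentFunctional A B₁ B₂ t₁ t₂) (j + 1) -
        2 * subCoeff (momentFunctional A B₁ B₂ t₁ t₂) j := fun j => by
    rw [← add_div, div_eq_iff (sqNorm_pos hL j).ne']
    linear_combination -boundary_op_sq hL (momentFunctional_ibp A B₁ B₂ t₁ t₂) j
  rw [Finset.sum_congr rfl fun j _ => hj j,
    Finset.sum_range_sub fun j => 2 * subCoeff (momentFunctional A B₁ B₂ t₁ t₂) j, subCoeff_zero]
  ring

/-- The boundary term of `P_{m+1} P_m / h_m` at the first jump. -/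
noncomputable def jumpTerm₁ (A B₁ B₂ : ℝ) (m : ℕ) (t₁ t₂ : ℝ) : ℝ :=
  B₁ * Real.exp (-t₁ ^ 2) * ((op (momentFunctional A B₁ B₂ t₁ t₂) (m + 1)).eval t₁ *
    (op (momentFunctional A B₁ B₂ t₁ t₂) m).eval t₁) / sqNorm (momentFunctional A B₁ B₂ t₁ t₂) m

/-- The boundary term of `P_{m+1} P_m / h_m` at the second jump. -/
noncomputable def jumpTerm₂ (A B₁ B₂ : ℝ) (m : ℕ) (t₁ t₂ : ℝ) : ℝ :=
  B₂ * Real.exp (-t₂ ^ 2) * ((op (momentFunctional A B₁ B₂ t₁ t₂) (m + 1)).eval t₂ *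
    (op (momentFunctional A B₁ B₂ t₁ t₂) m).eval t₂) / sqNorm (momentFunctional A B₁ B₂ t₁ t₂) m

lemma pd₁_sigma
    (hpos : ∀ t₁ t₂ : ℝ, t₁ < t₂ → PosFunctional (momentFunctional A B₁ B₂ t₁ t₂))
    (m : ℕ) (t₁ t₂ : ℝ) (ht : t₁ < t₂) :
    pd₁ (sigma A B₁ B₂ (m + 1)) t₁ t₂ = 2 * jumpTerm₁ A B₁ B₂ m t₁ t₂ := by
  rw [pd₁_congr (sigma_eq hpos (m + 1)) ht, pd₁]
  refine (((hasDerivAt_subCoeff (hasDerivAt_momentFunctional_left A B₁ B₂ t₁ t₂)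
    (fun n k => differentiableAt_left (contDiffOn_coeff_op (contDiffOn_momentFunctional A B₁ B₂)
      (fun p hp => hpos p.1 p.2 hp) n k) ht)
    ((eventually_lt_left ht).mono fun s hs => hpos s t₂ hs) m).const_mul 2).deriv).trans ?_
  rw [jumpTerm₁]
  ring

lemma pd₂_sigma
    (hpos : ∀ t₁ t₂ : ℝ, t₁ < t₂ → PosFunctional (momentFunctional A B₁ B₂ t₁ t₂))
    (m : ℕ) (t₁ t₂ : ℝ) (ht : t₁ < t₂) :
    pd₂ (sigma A B₁ B₂ (m + 1)) t₁ t₂ = 2 * jumpTerm₂ A B₁ B₂ m t₁ t₂ := by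
  rw [pd₂_congr (sigma_eq hpos (m + 1)) ht, pd₂]
  refine (((hasDerivAt_subCoeff (hasDerivAt_momentFunctional_right A B₁ B₂ t₁ t₂)
    (fun n k => differentiableAt_right (contDiffOn_coeff_op (contDiffOn_momentFunctional A B₁ B₂)
      (fun p hp => hpos p.1 p.2 hp) n k) ht)
    ((eventually_lt_right ht).mono fun s hs => hpos t₁ s hs) m).const_mul 2).deriv).trans ?_
  rw [jumpTerm₂]
  ring

lemma jumpTerm₁_add_jumpTerm₂
    (hpos : ∀ t₁ t₂ : ℝ, t₁ < t₂ → PosFunctional (momentFunctional A B₁ B₂ t₁ t₂))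
    (m : ℕ) (t₁ t₂ : ℝ) (ht : t₁ < t₂) :
    jumpTerm₁ A B₁ B₂ m t₁ t₂ + jumpTerm₂ A B₁ B₂ m t₁ t₂ =
      2 * (sqNorm (momentFunctional A B₁ B₂ t₁ t₂) (m + 1) /
        sqNorm (momentFunctional A B₁ B₂ t₁ t₂) m) - (m + 1) := by
  have hL := hpos t₁ t₂ ht
  have hk := (sqNorm_pos hL m).ne'
  rw [jumpTerm₁, jumpTerm₂, ← add_div,
    boundary_op_mul_op hL (momentFunctional_ibp A B₁ B₂ t₁ t₂)]
  field_simp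

lemma contDiffOn_jumpTerm₁
    (hpos : ∀ t₁ t₂ : ℝ, t₁ < t₂ → PosFunctional (momentFunctional A B₁ B₂ t₁ t₂)) (m : ℕ) :
    ContDiffOn ℝ ∞ (fun p : ℝ × ℝ => jumpTerm₁ A B₁ B₂ m p.1 p.2) {p : ℝ × ℝ | p.1 < p.2} := by
  have hpos' : ∀ p ∈ {p : ℝ × ℝ | p.1 < p.2}, PosFunctional (momentFunctional A B₁ B₂ p.1 p.2) :=
    fun p hp => hpos p.1 p.2 hp
  have hM := contDiffOn_momentFunctional A B₁ B₂
  have hev := fun n => contDiffOn_eval (τ := Prod.fst) (fun p : ℝ × ℝ =>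
    (natDegree_op (L := momentFunctional A B₁ B₂ p.1 p.2) n).le) (contDiffOn_coeff_op hM hpos' n)
    contDiff_fst.contDiffOn
  have hexp : ContDiffOn ℝ ∞ (fun p : ℝ × ℝ => B₁ * Real.exp (-p.1 ^ 2))
      {p : ℝ × ℝ | p.1 < p.2} := by fun_prop
  exact (hexp.mul ((hev (m + 1)).mul (hev m))).div (contDiffOn_sqNorm hM hpos' m)
    fun p hp => (sqNorm_pos (hpos' p hp) m).ne'

lemma contDiffOn_jumpTerm₂
    (hpos : ∀ t₁ t₂ : ℝ, t₁ < t₂ → PosFunctional (momentFunctional A B₁ B₂ t₁ t₂)) (m : ℕ) :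
    ContDiffOn ℝ ∞ (fun p : ℝ × ℝ => jumpTerm₂ A B₁ B₂ m p.1 p.2) {p : ℝ × ℝ | p.1 < p.2} := by
  have hpos' : ∀ p ∈ {p : ℝ × ℝ | p.1 < p.2}, PosFunctional (momentFunctional A B₁ B₂ p.1 p.2) :=
    fun p hp => hpos p.1 p.2 hp
  have hM := contDiffOn_momentFunctional A B₁ B₂
  have hev := fun n => contDiffOn_eval (τ := Prod.snd) (fun p : ℝ × ℝ =>
    (natDegree_op (L := momentFunctional A B₁ B₂ p.1 p.2) n).le) (contDiffOn_coeff_op hM hpos' n)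
    contDiff_snd.contDiffOn
  have hexp : ContDiffOn ℝ ∞ (fun p : ℝ × ℝ => B₂ * Real.exp (-p.2 ^ 2))
      {p : ℝ × ℝ | p.1 < p.2} := by fun_prop
  exact (hexp.mul ((hev (m + 1)).mul (hev m))).div (contDiffOn_sqNorm hM hpos' m)
    fun p hp => (sqNorm_pos (hpos' p hp) m).ne'

/-- Adding before differentiating leaves only the ratio of consecutive norms, so neither jump term
has to be differentiated explicitly. -/
lemma pd₁_pd₁_sigma_add_pd₁_pd₂_sigma
    (hpos : ∀ t₁ t₂ : ℝ, t₁ < t₂ → PosFunctional (momentFunctional A B₁ B₂ t₁ t₂))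
    (m : ℕ) {t₁ t₂ : ℝ} (ht : t₁ < t₂) :
    pd₁ (pd₁ (sigma A B₁ B₂ (m + 1))) t₁ t₂ + pd₁ (pd₂ (sigma A B₁ B₂ (m + 1))) t₁ t₂ =
      4 * (B₁ * Real.exp (-t₁ ^ 2)) * (sqNorm (momentFunctional A B₁ B₂ t₁ t₂) (m + 1) *
          (op (momentFunctional A B₁ B₂ t₁ t₂) m).eval t₁ ^ 2 -
        sqNorm (momentFunctional A B₁ B₂ t₁ t₂) m *
          (op (momentFunctional A B₁ B₂ t₁ t₂) (m + 1)).eval t₁ ^ 2) /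
        sqNorm (momentFunctional A B₁ B₂ t₁ t₂) m ^ 2 := by
  rw [pd₁_congr (pd₁_sigma hpos m) ht, pd₁_congr (pd₂_sigma hpos m) ht, pd₁, pd₁,
    ← deriv_fun_add ((differentiableAt_left (contDiffOn_jumpTerm₁ hpos m) ht).const_mul 2)
      ((differentiableAt_left (contDiffOn_jumpTerm₂ hpos m) ht).const_mul 2)]
  have hd := ((((hasDerivAt_sqNorm_left hpos ht (m + 1)).div (hasDerivAt_sqNorm_left hpos ht m)
    (sqNorm_pos (hpos t₁ t₂ ht) m).ne').const_mul 2).sub_const ((m : ℝ) + 1)).const_mul 2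
  have heq : (fun s => 2 * jumpTerm₁ A B₁ B₂ m s t₂ + 2 * jumpTerm₂ A B₁ B₂ m s t₂) =ᶠ[𝓝 t₁]
      fun s => 2 * (2 * (sqNorm (momentFunctional A B₁ B₂ s t₂) (m + 1) /
        sqNorm (momentFunctional A B₁ B₂ s t₂) m) - (m + 1)) := by
    filter_upwards [eventually_lt_left ht] with s hs
    rw [← jumpTerm₁_add_jumpTerm₂ hpos m s t₂ hs]
    ring
  refine ((hd.congr_of_eventuallyEq heq).deriv).trans ?_
  ring

lemma pd₂_pd₂_sigma_add_pd₂_pd₁_sigma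
    (hpos : ∀ t₁ t₂ : ℝ, t₁ < t₂ → PosFunctional (momentFunctional A B₁ B₂ t₁ t₂))
    (m : ℕ) {t₁ t₂ : ℝ} (ht : t₁ < t₂) :
    pd₂ (pd₂ (sigma A B₁ B₂ (m + 1))) t₁ t₂ + pd₂ (pd₁ (sigma A B₁ B₂ (m + 1))) t₁ t₂ =
      4 * (B₂ * Real.exp (-t₂ ^ 2)) * (sqNorm (momentFunctional A B₁ B₂ t₁ t₂) (m + 1) *
          (op (momentFunctional A B₁ B₂ t₁ t₂) m).eval t₂ ^ 2 -
        sqNorm (momentFunctional A B₁ B₂ t₁ t₂) m *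
          (op (momentFunctional A B₁ B₂ t₁ t₂) (m + 1)).eval t₂ ^ 2) /
        sqNorm (momentFunctional A B₁ B₂ t₁ t₂) m ^ 2 := by
  rw [pd₂_congr (pd₁_sigma hpos m) ht, pd₂_congr (pd₂_sigma hpos m) ht, pd₂, pd₂,
    ← deriv_fun_add ((differentiableAt_right (contDiffOn_jumpTerm₂ hpos m) ht).const_mul 2)
      ((differentiableAt_right (contDiffOn_jumpTerm₁ hpos m) ht).const_mul 2)]
  have hd := ((((hasDerivAt_sqNorm_right hpos ht (m + 1)).div (hasDerivAt_sqNorm_right hpos ht m)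
    (sqNorm_pos (hpos t₁ t₂ ht) m).ne').const_mul 2).sub_const ((m : ℝ) + 1)).const_mul 2
  have heq : (fun s => 2 * jumpTerm₂ A B₁ B₂ m t₁ s + 2 * jumpTerm₁ A B₁ B₂ m t₁ s) =ᶠ[𝓝 t₂]
      fun s => 2 * (2 * (sqNorm (momentFunctional A B₁ B₂ t₁ s) (m + 1) /
        sqNorm (momentFunctional A B₁ B₂ t₁ s) m) - (m + 1)) := by
    filter_upwards [eventually_lt_right ht] with s hs
    rw [← jumpTerm₁_add_jumpTerm₂ hpos m t₁ s hs]
    ring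
  refine ((hd.congr_of_eventuallyEq heq).deriv).trans ?_
  ring

/-- The discriminant of `u² + 4 v² (2β)` becomes a perfect square when `v² = β R R'`. -/
lemma jump_discriminant {E P Q h k : ℝ} (hk : k ≠ 0) :
    (4 * E * (h * Q ^ 2 - k * P ^ 2) / k ^ 2) ^ 2 +
        4 * (2 * (E * (P * Q) / k)) ^ 2 * (4 * (h / k)) =
      (4 * (E * (h * Q ^ 2 + k * P ^ 2)) / k ^ 2) ^ 2 := by
  field_simp
  ring

lemma sigma_pde
    (hpos : ∀ t₁ t₂ : ℝ, t₁ < t₂ → PosFunctional (momentFunctional A B₁ B₂ t₁ t₂))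
    (n : ℕ) {t₁ t₂ : ℝ} (ht : t₁ < t₂) :
    ((2 * t₁ * pd₁ (sigma A B₁ B₂ n) t₁ t₂ + 2 * t₂ * pd₂ (sigma A B₁ B₂ n) t₁ t₂ -
          2 * sigma A B₁ B₂ n t₁ t₂) ^ 2 -
        Delta₁ n (sigma A B₁ B₂ n) t₁ t₂ - Delta₂ n (sigma A B₁ B₂ n) t₁ t₂) ^ 2 =
      4 * Delta₁ n (sigma A B₁ B₂ n) t₁ t₂ * Delta₂ n (sigma A B₁ B₂ n) t₁ t₂ := by
  rcases n with _ | m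
  -- For n = 0 there is no P_{n-1}, but σ vanishes identically on the region.
  · have h0 : ∀ s₁ s₂ : ℝ, s₁ < s₂ → sigma A B₁ B₂ 0 s₁ s₂ = (fun _ _ => 0) s₁ s₂ :=
      fun s₁ s₂ hs => by rw [sigma_eq hpos 0 s₁ s₂ hs, subCoeff_zero, mul_zero]
    have h1 : pd₁ (sigma A B₁ B₂ 0) t₁ t₂ = 0 := by
      rw [pd₁_congr h0 ht, pd₁, deriv_const]
    have h2 : pd₂ (sigma A B₁ B₂ 0) t₁ t₂ = 0 := by
      rw [pd₂_congr h0 ht, pd₂, deriv_const]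
    have h3 : ∀ s₁ s₂ : ℝ, s₁ < s₂ → pd₁ (sigma A B₁ B₂ 0) s₁ s₂ = (fun _ _ => 0) s₁ s₂ :=
      fun s₁ s₂ hs => by rw [pd₁_congr h0 hs, pd₁, deriv_const]
    have h4 : ∀ s₁ s₂ : ℝ, s₁ < s₂ → pd₂ (sigma A B₁ B₂ 0) s₁ s₂ = (fun _ _ => 0) s₁ s₂ :=
      fun s₁ s₂ hs => by rw [pd₂_congr h0 hs, pd₂, deriv_const]
    rw [Delta₁, Delta₂, pd₁_congr h3 ht, pd₁_congr h4 ht, pd₂_congr h3 ht, pd₂_congr h4 ht,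
      h3 t₁ t₂ ht, h4 t₁ t₂ ht, h0 t₁ t₂ ht, pd₁, pd₂, deriv_const, deriv_const]
    simp
  · have hL := hpos t₁ t₂ ht
    have hk := (sqNorm_pos hL m).ne'
    have ibp := momentFunctional_ibp A B₁ B₂ t₁ t₂
    have hsum : 2 * ((m + 1 : ℕ) : ℝ) + 2 * jumpTerm₁ A B₁ B₂ m t₁ t₂ +
        2 * jumpTerm₂ A B₁ B₂ m t₁ t₂ = 4 * (sqNorm (momentFunctional A B₁ B₂ t₁ t₂) (m + 1) /
          sqNorm (momentFunctional A B₁ B₂ t₁ t₂) m) := by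
      push_cast
      linear_combination 2 * jumpTerm₁_add_jumpTerm₂ hpos m t₁ t₂ ht
    have hX := boundary_X_mul_op_mul_op hL ibp m
    have hP := boundary_op_sq hL ibp (m + 1)
    have hQ := boundary_op_sq hL ibp m
    rw [Delta₁, Delta₂, pd₁_pd₁_sigma_add_pd₁_pd₂_sigma hpos m ht,
      pd₂_pd₂_sigma_add_pd₂_pd₁_sigma hpos m ht, pd₁_sigma hpos m t₁ t₂ ht,
      pd₂_sigma hpos m t₁ t₂ ht, hsum, sigma_eq hpos (m + 1) t₁ t₂ ht, jumpTerm₁, jumpTerm₂,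
      jump_discriminant hk, jump_discriminant hk]
    set M := momentFunctional A B₁ B₂ t₁ t₂
    set E₁ := B₁ * Real.exp (-t₁ ^ 2)
    set E₂ := B₂ * Real.exp (-t₂ ^ 2)
    -- The right side is S₁ + S₂, the sum of the roots of the two squares just obtained; the
    -- recurrence coefficients cancel between the three boundary identities.
    have key : 2 * t₁ * (2 * (E₁ * ((op M (m + 1)).eval t₁ * (op M m).eval t₁) / sqNorm M m)) +
        2 * t₂ * (2 * (E₂ * ((op M (m + 1)).eval t₂ * (op M m).eval t₂) / sqNorm M m)) -
        2 * (2 * subCoeff M (m + 1)) =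
        4 * (E₁ * (sqNorm M (m + 1) * (op M m).eval t₁ ^ 2 +
          sqNorm M m * (op M (m + 1)).eval t₁ ^ 2)) / sqNorm M m ^ 2 +
        4 * (E₂ * (sqNorm M (m + 1) * (op M m).eval t₂ ^ 2 +
          sqNorm M m * (op M (m + 1)).eval t₂ ^ 2)) / sqNorm M m ^ 2 := by
      field_simp
      linear_combination 4 * sqNorm M m * hX - 4 * sqNorm M (m + 1) * hQ - 4 * sqNorm M m * hP
    rw [key]
    ring

end Assembly

end GaussJumps

theorem mainTheorem1 (A B₁ B₂ : ℝ) (hA : 0 ≤ A) (hAB₁ : 0 ≤ A + B₁)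
    (hAB₁B₂ : 0 ≤ A + B₁ + B₂) (hB₁ : B₁ ≠ 0) (hB₂ : B₂ ≠ 0) (n : ℕ) :
    (∀ t₁ t₂ : ℝ, t₁ < t₂ → 0 < GaussJumps.D A B₁ B₂ n t₁ t₂) ∧
    ContDiffOn ℝ ∞ (fun p : ℝ × ℝ => GaussJumps.logD A B₁ B₂ n p.1 p.2)
      {p : ℝ × ℝ | p.1 < p.2} ∧
    ContDiffOn ℝ ∞ (fun p : ℝ × ℝ => GaussJumps.sigma A B₁ B₂ n p.1 p.2)
      {p : ℝ × ℝ | p.1 < p.2} ∧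
    ∀ t₁ t₂ : ℝ, t₁ < t₂ →
      ((2 * t₁ * GaussJumps.pd₁ (GaussJumps.sigma A B₁ B₂ n) t₁ t₂ +
          2 * t₂ * GaussJumps.pd₂ (GaussJumps.sigma A B₁ B₂ n) t₁ t₂ -
          2 * GaussJumps.sigma A B₁ B₂ n t₁ t₂) ^ 2 -
        GaussJumps.Delta₁ n (GaussJumps.sigma A B₁ B₂ n) t₁ t₂ -
        GaussJumps.Delta₂ n (GaussJumps.sigma A B₁ B₂ n) t₁ t₂) ^ 2 =
      4 * GaussJumps.Delta₁ n (GaussJumps.sigma A B₁ B₂ n) t₁ t₂ *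
        GaussJumps.Delta₂ n (GaussJumps.sigma A B₁ B₂ n) t₁ t₂ := by
  have hpos : ∀ t₁ t₂ : ℝ, t₁ < t₂ →
      GaussJumps.PosFunctional (GaussJumps.momentFunctional A B₁ B₂ t₁ t₂) :=
    fun t₁ t₂ ht => GaussJumps.posFunctional_momentFunctional hA hAB₁ hAB₁B₂ hB₁ ht
  have hM := GaussJumps.contDiffOn_momentFunctional A B₁ B₂
  refine ⟨fun t₁ t₂ ht => ?_, ?_, ?_, fun t₁ t₂ ht => GaussJumps.sigma_pde hpos n ht⟩
  · rw [GaussJumps.D_eq_prod_sqNorm (hpos t₁ t₂ ht)]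
    exact Finset.prod_pos fun j _ => GaussJumps.sqNorm_pos (hpos t₁ t₂ ht) j
  · refine ContDiffOn.congr ?_ fun p hp => GaussJumps.logD_eq_sum hpos n p.1 p.2 hp
    exact ContDiffOn.sum fun j _ =>
      (GaussJumps.contDiffOn_sqNorm hM (fun p hp => hpos p.1 p.2 hp) j).log
        fun p hp => (GaussJumps.sqNorm_pos (hpos p.1 p.2 hp) j).ne'
  · refine ContDiffOn.congr ?_ fun p hp => GaussJumps.sigma_eq hpos n p.1 p.2 hp
    exact contDiffOn_const.mul
      (GaussJumps.contDiffOn_subCoeff hM (fun p hp => hpos p.1 p.2 hp) n)
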